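/- The classical scalar weights are the following, where $\partial = d/dx$ and $\partial^i f$ denotes the operator $p \mapsto p \cdot \partial^i f = p^{(i)} f$: * shifted Hermite, $b\in\mathbb R$: $w(x)=e^{-x^2+2bx}$ on $(-\infty,\infty)$, with $\delta=\partial^2-2\,\partial(x-b)$; * Laguerre, $\alpha>-1$: $w(x)=e^{-x}x^{\alpha}$ on $(0,\infty)$, with $\delta=\partial^2x+\partial(\alpha+1-x)$; * Jacobi, $\alpha,\beta>-1$: $w(x)=(1-x)^\alpha(1+x)^\beta$ on $(-1,1)$, with $\delta=\partial^2(1-x^2)+\partial(\beta-\alpha-x(\alpha+\beta+2))$. For a weight matrix $W$ of size $N$ on an interval, with monic orthogonal polynomials $(P_n)_{n\ge0}$ with respect to $\langle P,Q\rangle_W=\int P(x)W(x)Q(x)^*\,dx$, let $\mathcal D(W)$ be the algebra of all differential operators $D=\sum_i\partial^iF_i$, $F_i\in\operatorname{Mat}_N(\mathbb C[x])$, acting on the right by $P\cdot D=\sum_i P^{(i)}F_i$, such that for every $n\ge0$ there is $\Lambda_n\in\operatorname{Mat}_N(\mathbb C)$ with $P_n\cdot D=\Lambda_nP_n$; let $\mathcal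 Z(W)$ be its center. A weight $\widetilde W$ on the same interval, with monic orthogonal polynomials $\widetilde P_n$, is a Darboux transformation of $W$ if there are differential operators $\mathcal V,\mathcal N$ with coefficients in $\operatorname{Mat}_N(\mathbb C[x])$ that preserve the degree of every matrix polynomial, such that $\mathcal V\mathcal N\in\mathcal D(W)$ and, for all $n\ge 0$, $P_n\cdot\mathcal V=A_n\widetilde P_n$ for some $A_n\in\operatorname{Mat}_N(\mathbb C)$; this is an equivalence relation. Theorem. Let $N\ge1$, let $w_1,\dots,w_N$ be classical scalar weights in the same Darboux equivalence class (each $w_j$ is a Darboux transformation of each $w_i$), let $\delta_j$ be the second-order operator associated with $w_j$ above, and put $\Delta=\operatorname{diag}(\delta_1,\dots,\delta_N)$. Then the center of $\mathcal D(w_1\oplus\cdots\oplus w_N)$ is the polynomial algebra $\mathbb C[\Delta]$ generated by $\Delta$ (and $\Delta$ is transcendental over $\mathbb C$). Explicitly, $$\mathcal Z(w_1\oplus\cdots\oplus w_N)=\{p(\Delta):p\in\mathbb C[x]\}=\{\operatorname{diag}(p(\delta_1),\dots,p(\delta_N)):p\in\mathbb C[x]\}.$$ -/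

import Mathlib

open Polynomial MeasureTheory
open scoped ComplexOrder ContDiff

noncomputable section

/-! ### Scalar differential operators with polynomial coefficients, acting on the right -/

/-- The algebra `Ω[x]` of the operators `∑ j, ∂ ^ j f_j` with `f_j ∈ ℂ[x]`, which act on the right
by `p · D = ∑ j, p^(j) f_j`. An operator is identified with its action on `ℂ[x]`; since operators
act on the right, the product `D₁ D₂` means "first `D₁`, then `D₂`", whence the opposite algebra. -/
def WeylAlgebra : Subalgebra ℂ (Module.End ℂ ℂ[X])ᵐᵒᵖ where
  carrier := {D | ∃ (m : ℕ) (f : ℕ → ℂ[X]), ∀ p : ℂ[X],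
    D.unop p = ∑ j ∈ Finset.range m, derivative^[j] p * f j}
  algebraMap_mem' := by
    intro r
    refine ⟨1, fun _ => C r, fun p => ?_⟩
    simp [MulOpposite.algebraMap_apply, Polynomial.smul_eq_C_mul, mul_comm]
  add_mem' := by
    rintro a b ⟨m, f, hf⟩ ⟨k, g, hg⟩
    have extend : ∀ (n M : ℕ) (h : ℕ → ℂ[X]) (p : ℂ[X]), n ≤ M →
        ∑ j ∈ Finset.range n, derivative^[j] p * h j =
          ∑ j ∈ Finset.range M, derivative^[j] p * (if j < n then h j else 0) := by
      intro n M h p hnM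
      rw [← Finset.sum_subset (Finset.range_mono hnM)]
      · exact Finset.sum_congr rfl fun j hj => by simp [Finset.mem_range.1 hj]
      · intro j _ hj
        simp [Finset.mem_range] at hj
        simp [not_lt.2 hj]
    refine ⟨max m k, fun j => (if j < m then f j else 0) + (if j < k then g j else 0),
      fun p => ?_⟩
    simp only [MulOpposite.unop_add, LinearMap.add_apply, hf, hg, mul_add, Finset.sum_add_distrib]
    rw [extend m (max m k) f p (le_max_left _ _), extend k (max m k) g p (le_max_right _ _)]
  mul_mem' := by
    rintro a b ⟨m, f, hf⟩ ⟨k, g, hg⟩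
    have key : ∀ i : ℕ, ∃ (M : ℕ) (c : ℕ → ℂ[X]), ∀ p : ℂ[X],
        derivative^[i] (a.unop p) = ∑ j ∈ Finset.range M, derivative^[j] p * c j := by
      intro i
      induction i with
      | zero => exact ⟨m, f, hf⟩
      | succ i ih =>
        obtain ⟨M, c, hc⟩ := ih
        refine ⟨M + 1, fun j => (if j < M then derivative (c j) else 0) +
          (if j = 0 then 0 else c (j - 1)), fun p => ?_⟩
        rw [Function.iterate_succ_apply', hc]
        simp only [derivative_sum, derivative_mul, mul_add, Finset.sum_add_distrib]
        rw [Finset.sum_range_succ, Finset.sum_range_succ']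
        simp only [← Function.iterate_succ_apply' derivative]
        rw [add_comm]
        simp
        exact Finset.sum_congr rfl fun j hj => by simp [Finset.mem_range.1 hj]
    have tot : ∀ n : ℕ, ∃ (M : ℕ) (c : ℕ → ℂ[X]), ∀ p : ℂ[X],
        ∑ i ∈ Finset.range n, derivative^[i] (a.unop p) * g i =
          ∑ j ∈ Finset.range M, derivative^[j] p * c j := by
      intro n
      induction n with
      | zero => exact ⟨0, 0, by simp⟩
      | succ n ih =>
        obtain ⟨M₁, c₁, h₁⟩ := ih
        obtain ⟨M₂, c₂, h₂⟩ := key n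
        refine ⟨max M₁ M₂, fun j => (if j < M₁ then c₁ j else 0) +
          (if j < M₂ then c₂ j * g n else 0), fun p => ?_⟩
        rw [Finset.sum_range_succ, h₁, h₂]
        simp only [mul_add, Finset.sum_add_distrib, mul_ite, mul_zero, ← Finset.sum_filter,
          Finset.sum_mul]
        congr 1
        · refine Finset.sum_congr ?_ fun _ _ => rfl
          ext j; simp; omega
        · refine Finset.sum_congr ?_ fun _ _ => by ring
          ext j; simp; omega
    obtain ⟨M, c, hc⟩ := tot k
    refine ⟨M, c, fun p => ?_⟩
    rw [MulOpposite.unop_mul, Module.End.mul_apply, hg, hc]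

namespace WeylAlgebra

/-- The operator `∂ = d/dx`. -/
def dx : WeylAlgebra :=
  ⟨MulOpposite.op derivative, 2, fun j => if j = 1 then 1 else 0, fun p => by simp⟩

/-- The operator `p ↦ p f` of order zero. -/
def mulBy (f : ℂ[X]) : WeylAlgebra :=
  ⟨MulOpposite.op (LinearMap.mulRight ℂ f), 1, fun _ => f, fun p => by simp⟩

/-- The right action `p · D` of a scalar differential operator on a polynomial. -/
def act (p : ℂ[X]) (D : WeylAlgebra) : ℂ[X] := (D : (Module.End ℂ ℂ[X])ᵐᵒᵖ).unop p

end WeylAlgebra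

/-! ### Matrix differential operators -/

section MatrixOperators

variable {ι : Type*} [Fintype ι]

/-- The right action `(P · D)_{ij} = ∑ k, P_{ik} · D_{kj}` of a matrix differential operator
`D ∈ Mat_N(Ω[x])` on a matrix polynomial. -/
def matAct (P : Matrix ι ι ℂ[X]) (D : Matrix ι ι WeylAlgebra) : Matrix ι ι ℂ[X] :=
  Matrix.of fun i j => ∑ k, WeylAlgebra.act (P i k) (D k j)

/-- The degree of a matrix polynomial (`⊥` for the zero polynomial). -/
def matDegree (P : Matrix ι ι ℂ[X]) : WithBot ℕ :=
  Finset.univ.sup fun ij : ι × ι => (P ij.1 ij.2).degree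

/-- Operators that preserve the degree of every matrix polynomial. -/
def IsDegreePreserving (V : Matrix ι ι WeylAlgebra) : Prop :=
  ∀ P : Matrix ι ι ℂ[X], matDegree (matAct P V) = matDegree P

theorem matAct_add (P : Matrix ι ι ℂ[X]) (D E : Matrix ι ι WeylAlgebra) :
    matAct P (D + E) = matAct P D + matAct P E := by
  ext1 i j
  simp [matAct, WeylAlgebra.act, Finset.sum_add_distrib]

theorem matAct_mul (P : Matrix ι ι ℂ[X]) (D E : Matrix ι ι WeylAlgebra) :
    matAct P (D * E) = matAct (matAct P D) E := by
  ext1 i j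
  simp only [matAct, WeylAlgebra.act, Matrix.of_apply, Matrix.mul_apply,
    AddSubmonoidClass.coe_finsetSum, Finset.unop_sum, LinearMap.sum_apply, map_sum,
    MulMemClass.coe_mul, MulOpposite.unop_mul, Module.End.mul_apply]
  exact Finset.sum_comm

theorem matAct_algebraMap [DecidableEq ι] (P : Matrix ι ι ℂ[X]) (r : ℂ) :
    matAct P (algebraMap ℂ (Matrix ι ι WeylAlgebra) r) =
      (algebraMap ℂ (Matrix ι ι ℂ) r).map C * P := by
  ext1 i j
  simp only [matAct, WeylAlgebra.act, Matrix.of_apply, Matrix.algebraMap_matrix_apply,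
    Matrix.mul_apply, Matrix.map_apply]
  rw [Finset.sum_eq_single j, Finset.sum_eq_single i]
  · simp [MulOpposite.algebraMap_apply, Polynomial.smul_eq_C_mul]
  · intro k _ hk; simp [hk.symm]
  · simp
  · intro k _ hk; simp [hk]
  · simp

theorem matAct_const_mul (L : Matrix ι ι ℂ) (P : Matrix ι ι ℂ[X]) (D : Matrix ι ι WeylAlgebra) :
    matAct (L.map C * P) D = L.map C * matAct P D := by
  ext1 i j
  simp only [matAct, WeylAlgebra.act, Matrix.of_apply, Matrix.mul_apply, Matrix.map_apply,
    map_sum, ← Polynomial.smul_eq_C_mul, map_smul, Finset.smul_sum]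
  exact Finset.sum_comm

end MatrixOperators

/-! ### Weight matrices, orthogonal polynomials, the algebra `𝒟(W)` and its center -/

/-- A weight matrix on the open interval `I`: a smooth matrix function on `I`, positive definite
almost everywhere, with finite moments of all orders. (Values outside `I` play no role.) -/
structure WeightMatrix (I : Set ℝ) (ι : Type*) [Fintype ι] where
  toFun : ℝ → Matrix ι ι ℂ
  isOpen : IsOpen I
  ordConnected : I.OrdConnected
  nonempty : I.Nonempty
  smooth : ∀ i j, ContDiffOn ℝ ∞ (fun x => toFun x i j) I
  posDef : ∀ᵐ x ∂(volume.restrict I), (toFun x).PosDef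
  moments : ∀ (n : ℕ) (i j : ι), IntegrableOn (fun x : ℝ => (x : ℂ) ^ n * toFun x i j) I

namespace WeightMatrix

variable {I : Set ℝ} {ι : Type*} [Fintype ι] [DecidableEq ι]

/-- The matrix-valued sesquilinear form `⟨P, Q⟩_W = ∫_I P(x) W(x) Q(x)^* dx`. -/
def form (W : WeightMatrix I ι) (P Q : Matrix ι ι ℂ[X]) : Matrix ι ι ℂ :=
  Matrix.of fun i j => ∫ x in I,
    (P.map (eval (x : ℂ)) * W.toFun x * (Q.map (eval (x : ℂ))).conjTranspose) i j

/-- `P` is the sequence of monic orthogonal polynomials of `W`. -/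
structure IsMonicOrthogonal (W : WeightMatrix I ι) (P : ℕ → Matrix ι ι ℂ[X]) : Prop where
  monic : ∀ n, (P n).map (fun p => p.coeff n) = 1
  degree_le : ∀ n m, n < m → (P n).map (fun p => p.coeff m) = 0
  orthogonal : ∀ n m, n ≠ m → W.form (P n) (P m) = 0

/-- The algebra `𝒟(W)` of the operators having the orthogonal polynomials as eigenfunctions. -/
def diffAlgebra (W : WeightMatrix I ι) : Subalgebra ℂ (Matrix ι ι WeylAlgebra) where
  carrier := {D | ∀ P : ℕ → Matrix ι ι ℂ[X], W.IsMonicOrthogonal P →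
    ∀ n, ∃ L : Matrix ι ι ℂ, matAct (P n) D = L.map C * P n}
  algebraMap_mem' := fun r P _ n => ⟨_, matAct_algebraMap (P n) r⟩
  add_mem' := by
    intro D E hD hE P hP n
    obtain ⟨L, hL⟩ := hD P hP n
    obtain ⟨M, hM⟩ := hE P hP n
    exact ⟨L + M, by rw [matAct_add, hL, hM, Matrix.map_add _ (map_add C), add_mul]⟩
  mul_mem' := by
    intro D E hD hE P hP n
    obtain ⟨L, hL⟩ := hD P hP n
    obtain ⟨M, hM⟩ := hE P hP n
    exact ⟨L * M, by rw [matAct_mul, hL, matAct_const_mul, hM, Matrix.map_mul, mul_assoc]⟩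

/-- The center `𝒵(W)` of the algebra `𝒟(W)`, as an algebra of differential operators. -/
def center (W : WeightMatrix I ι) : Subalgebra ℂ (Matrix ι ι WeylAlgebra) :=
  (Subalgebra.center ℂ W.diffAlgebra).map W.diffAlgebra.val

/-- `W'` is a Darboux transformation of `W` (weights on the same interval): some operator of
`𝒟(W)` factors as `V N` with degree-preserving `V`, `N`, and `V` maps the monic orthogonal
polynomials of `W` to left multiples of those of `W'`. -/
def IsDarbouxTransformation (W W' : WeightMatrix I ι) : Prop :=
  ∃ V N : Matrix ι ι WeylAlgebra, IsDegreePreserving V ∧ IsDegreePreserving N ∧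
    V * N ∈ W.diffAlgebra ∧
    ∀ P P' : ℕ → Matrix ι ι ℂ[X], W.IsMonicOrthogonal P → W'.IsMonicOrthogonal P' →
      ∀ n, ∃ A : Matrix ι ι ℂ, matAct (P n) V = A.map C * P' n

end WeightMatrix

/-! ### Classical scalar weights -/

/-- The three types of classical scalar weights. -/
inductive ClassicalType
  | hermite
  | laguerre
  | jacobi

/-- The interval on which the weights of a given type live. -/
def ClassicalType.interval : ClassicalType → Set ℝ
  | .hermite => Set.univ
  | .laguerre => Set.Ioi 0
  | .jacobi => Set.Ioo (-1) 1

/-- The classical scalar weights of each type, given by their parameters. -/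
inductive ClassicalWeight : ClassicalType → Type
  | hermite (b : ℝ) : ClassicalWeight .hermite
  | laguerre (α : ℝ) (hα : -1 < α) : ClassicalWeight .laguerre
  | jacobi (α β : ℝ) (hα : -1 < α) (hβ : -1 < β) : ClassicalWeight .jacobi

namespace ClassicalWeight

/-- The weight function: `e^{-x^2+2bx}`, `e^{-x} x^α`, `(1-x)^α (1+x)^β`. -/
def fn : {t : ClassicalType} → ClassicalWeight t → ℝ → ℝ
  | _, hermite b => fun x => Real.exp (-x ^ 2 + 2 * b * x)
  | _, laguerre α _ => fun x => Real.exp (-x) * x ^ α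
  | _, jacobi α β _ _ => fun x => (1 - x) ^ α * (1 + x) ^ β

open WeylAlgebra in
/-- The second-order operator: `∂² - 2 ∂ (x - b)`, `∂² x + ∂ (α + 1 - x)`,
`∂² (1 - x²) + ∂ (β - α - x (α + β + 2))`. -/
def delta : {t : ClassicalType} → ClassicalWeight t → WeylAlgebra
  | _, hermite b => dx ^ 2 - 2 * (dx * mulBy (X - C (b : ℂ)))
  | _, laguerre α _ => dx ^ 2 * mulBy X + dx * mulBy (C ((α : ℂ) + 1) - X)
  | _, jacobi α β _ _ => dx ^ 2 * mulBy (1 - X ^ 2) +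
      dx * mulBy (C ((β : ℂ) - α) - X * C ((α : ℂ) + β + 2))

theorem isOpen_interval (t : ClassicalType) : IsOpen t.interval := by
  cases t
  · exact isOpen_univ
  · exact isOpen_Ioi
  · exact isOpen_Ioo

theorem ordConnected_interval (t : ClassicalType) : t.interval.OrdConnected := by
  cases t
  · exact Set.ordConnected_univ
  · exact Set.ordConnected_Ioi
  · exact Set.ordConnected_Ioo

theorem nonempty_interval (t : ClassicalType) : t.interval.Nonempty := by
  cases t
  · exact Set.univ_nonempty
  · exact Set.nonempty_Ioi
  · exact Set.nonempty_Ioo.2 (by norm_num)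

theorem fn_pos {t : ClassicalType} (w : ClassicalWeight t) {x : ℝ} (hx : x ∈ t.interval) :
    0 < w.fn x := by
  cases w with
  | hermite b => exact Real.exp_pos _
  | laguerre α hα => exact mul_pos (Real.exp_pos _) (Real.rpow_pos_of_pos hx _)
  | jacobi α β hα hβ =>
    exact mul_pos (Real.rpow_pos_of_pos (by linarith [hx.2]) _)
      (Real.rpow_pos_of_pos (by linarith [hx.1]) _)

theorem fn_smooth {t : ClassicalType} (w : ClassicalWeight t) :
    ContDiffOn ℝ ∞ w.fn t.interval := by
  cases w with
  | hermite b =>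
    refine ContDiff.contDiffOn ?_
    unfold fn
    fun_prop
  | laguerre α hα =>
    intro x hx
    have h0 : x ≠ 0 := ne_of_gt hx
    refine ContDiffAt.contDiffWithinAt ?_
    exact ContDiffAt.mul (by fun_prop) (contDiffAt_id.rpow_const_of_ne h0)
  | jacobi α β hα hβ =>
    intro x hx
    have h1 : (1 - x) ≠ 0 := ne_of_gt (by linarith [hx.2])
    have h2 : (1 + x) ≠ 0 := ne_of_gt (by linarith [hx.1])
    refine ContDiffAt.contDiffWithinAt ?_
    exact ContDiffAt.mul (ContDiffAt.rpow_const_of_ne (by fun_prop) h1)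
      (ContDiffAt.rpow_const_of_ne (by fun_prop) h2)

theorem fn_moments {t : ClassicalType} (w : ClassicalWeight t) (n : ℕ) :
    IntegrableOn (fun x : ℝ => x ^ n * w.fn x) t.interval := by
  cases w with
  | hermite b =>
    have h0 : ∀ k : ℕ, Integrable fun y : ℝ => y ^ k * Real.exp (-1 * y ^ 2) := fun k => by
      simpa using integrable_rpow_mul_exp_neg_mul_sq one_pos
        (s := (k : ℝ)) (by linarith [k.cast_nonneg (α := ℝ)])
    have h1 : Integrable fun y : ℝ => (y + b) ^ n * Real.exp (-1 * y ^ 2) := by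
      simp only [add_pow, Finset.sum_mul]
      refine integrable_finsetSum _ fun k _ => ?_
      refine ((h0 k).mul_const (b ^ (n - k) * n.choose k)).congr (Filter.Eventually.of_forall ?_)
      intro y
      simp only
      ring
    refine (((h1.comp_sub_right b).mul_const (Real.exp (b ^ 2))).congr
      (Filter.Eventually.of_forall ?_)).integrableOn
    intro x
    simp only [sub_add_cancel, fn, mul_assoc, ← Real.exp_add]
    ring_nf
  | laguerre α hα =>
    have h := Real.GammaIntegral_convergent (s := n + α + 1)
      (by linarith [n.cast_nonneg (α := ℝ)])
    refine h.congr_fun ?_ measurableSet_Ioi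
    intro x hx
    simp only [fn, add_sub_cancel_right]
    rw [Real.rpow_add hx, Real.rpow_natCast]
    ring
  | jacobi α β hα hβ =>
    have hl : IntervalIntegrable (fun x : ℝ => (1 + x) ^ β * (x ^ n * (1 - x) ^ α))
        volume (-1) 0 := by
      refine IntervalIntegrable.mul_continuousOn ?_ ?_
      · have := (intervalIntegral.intervalIntegrable_rpow' hβ (a := 0) (b := 1)).comp_add_left 1
        simpa using this
      · rw [Set.uIcc_of_le (by norm_num)]
        refine (continuousOn_pow n).mul (ContinuousOn.rpow_const (by fun_prop) ?_)
        exact fun x hx => Or.inl (by linarith [hx.2])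
    have hr : IntervalIntegrable (fun x : ℝ => (1 - x) ^ α * (x ^ n * (1 + x) ^ β))
        volume 0 1 := by
      refine IntervalIntegrable.mul_continuousOn ?_ ?_
      · have := (intervalIntegral.intervalIntegrable_rpow' hα (a := 1) (b := 0)).comp_sub_left 1
        simpa using this
      · rw [Set.uIcc_of_le (by norm_num)]
        refine (continuousOn_pow n).mul (ContinuousOn.rpow_const (by fun_prop) ?_)
        exact fun x hx => Or.inl (by linarith [hx.1])
    have hl' : IntervalIntegrable (fun x : ℝ => x ^ n * ((1 - x) ^ α * (1 + x) ^ β))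
        volume (-1) 0 := by
      convert hl using 2
      ring
    have hr' : IntervalIntegrable (fun x : ℝ => x ^ n * ((1 - x) ^ α * (1 + x) ^ β))
        volume 0 1 := by
      convert hr using 2
      ring
    exact (intervalIntegrable_iff_integrableOn_Ioo_of_le (by norm_num)).1 (hl'.trans hr')

/-- The direct sum `w_1 ⊕ ⋯ ⊕ w_N` of classical scalar weights of the same type. -/
def directSum {t : ClassicalType} {ι : Type*} [Fintype ι] [DecidableEq ι]
    (w : ι → ClassicalWeight t) : WeightMatrix t.interval ι where
  toFun x := Matrix.diagonal fun i => (((w i).fn x : ℝ) : ℂ)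
  isOpen := isOpen_interval t
  ordConnected := ordConnected_interval t
  nonempty := nonempty_interval t
  smooth := by
    intro i j
    by_cases h : i = j
    · subst h
      simp only [Matrix.diagonal_apply_eq]
      exact Complex.ofRealCLM.contDiff.comp_contDiffOn (fn_smooth (w i))
    · simp only [Matrix.diagonal_apply_ne _ h]
      exact contDiffOn_const
  posDef := by
    refine (ae_restrict_iff' (isOpen_interval t).measurableSet).2 (Filter.Eventually.of_forall ?_)
    intro x hx
    exact Matrix.PosDef.diagonal fun i => by exact_mod_cast fn_pos (w i) hx
  moments := by
    intro n i j
    by_cases h : i = j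
    · subst h
      simp only [Matrix.diagonal_apply_eq]
      exact_mod_cast (fn_moments (w i) n).ofReal (𝕜 := ℂ)
    · simp only [Matrix.diagonal_apply_ne _ h, mul_zero]
      exact integrableOn_zero

/-- A classical scalar weight as a weight matrix of size one. -/
def weight {t : ClassicalType} (w : ClassicalWeight t) : WeightMatrix t.interval Unit :=
  directSum fun _ => w

end ClassicalWeight

end

/-!
An operator belongs to `𝒟(w_1 ⊕ ⋯ ⊕ w_N)` when its `(i, j)` entry maps the orthogonal polynomials
of `w_i` to multiples of those of `w_j`. For a single classical weight this forces the entry to be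
a polynomial in `δ`. If the coefficient of `∂²` vanishes at a point `x₀`, differentiating the
equation `p · δ = λ p` at `x₀` expresses `p^(j)(x₀)` as `q_j(λ) p(x₀)`, so that `∑ j, ∂ ^ j f_j` has
the eigenvalue `∑ j, q_j(λ) f_j(x₀)`. For Hermite weights the eigenvalue of degree `n` is a
polynomial in `n`, hence in `λ_n = -2 n`.

A Darboux transformation supplies intertwiners between `w_i` and `w_j` in both directions, and these
can only exist if `δ_i` and `δ_j` have the same eigenvalues. Therefore `p(Δ)` commutes with every
operator of the algebra. Conversely, a central operator is diagonal because it commutes with the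
diagonal idempotents, and its entries are the same polynomial in the `δ_i` because it commutes with
the intertwiners.
-/

noncomputable section

open scoped ComplexConjugate

section Polynomials

/-- The operator `T` on polynomials is upper triangular with diagonal `c` in the basis of
monomials. -/
def IsDegreeTriangular {R : Type*} [Ring R] (T : R[X] →ₗ[R] R[X]) (c : ℕ → R) : Prop :=
  ∀ n, T (X ^ n) - c n • X ^ n ∈ degreeLT R n

namespace IsDegreeTriangular

section Ring

variable {R : Type*} [Ring R] {T : R[X] →ₗ[R] R[X]} {c : ℕ → R}

theorem coeff_map_X_pow (hT : IsDegreeTriangular T c) (n : ℕ) : (T (X ^ n)).coeff n = c n := by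
  have h := (degree_lt_iff_coeff_zero _ _).1 (mem_degreeLT.1 (hT n)) n le_rfl
  simpa [sub_eq_zero] using h

theorem map_mem_degreeLT (hT : IsDegreeTriangular T c) {p : R[X]} {n : ℕ}
    (hp : p ∈ degreeLT R n) : T p ∈ degreeLT R n := by
  classical
  suffices h : degreeLT R n ≤ (degreeLT R n).comap T from h hp
  nth_rw 1 [degreeLT_eq_span_X_pow]
  refine Submodule.span_le.2 fun q hq => ?_
  obtain ⟨k, hk, rfl⟩ : ∃ k < n, X ^ k = q := by simpa using hq
  have hlow : T (X ^ k) - c k • X ^ k ∈ degreeLT R n := degreeLT_mono hk.le (hT k)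
  have hXk : (X ^ k : R[X]) ∈ degreeLT R n :=
    mem_degreeLT.2 ((degree_X_pow_le k).trans_lt (by exact_mod_cast hk))
  simpa using add_mem hlow (Submodule.smul_mem _ (c k) hXk)

theorem coeff_map_natDegree (hT : IsDegreeTriangular T c) (p : R[X]) :
    (T p).coeff p.natDegree = p.leadingCoeff * c p.natDegree := by
  rcases eq_or_ne p 0 with rfl | hp
  · simp
  have hlow : (T p.eraseLead).coeff p.natDegree = 0 := by
    refine (degree_lt_iff_coeff_zero _ _).1 (mem_degreeLT.1 (hT.map_mem_degreeLT ?_)) _ le_rfl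
    rw [mem_degreeLT, ← degree_eq_natDegree hp]
    exact degree_eraseLead_lt hp
  have hsplit : T p = T p.eraseLead + p.leadingCoeff • T (X ^ p.natDegree) := by
    rw [← map_smul, ← map_add, smul_eq_C_mul, eraseLead_add_C_mul_X_pow]
  rw [hsplit, coeff_add, hlow, zero_add, coeff_smul, hT.coeff_map_X_pow, smul_eq_mul]

end Ring

theorem eigenvalue_eq {R : Type*} [CommRing R] [IsDomain R] {T : R[X] →ₗ[R] R[X]} {c : ℕ → R}
    (hT : IsDegreeTriangular T c) {p : R[X]} (hp : p ≠ 0) {μ : R} (h : T p = μ • p) :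
    μ = c p.natDegree := by
  have hcoeff := hT.coeff_map_natDegree p
  rw [h, coeff_smul, smul_eq_mul, coeff_natDegree, mul_comm] at hcoeff
  exact mul_left_cancel₀ (leadingCoeff_ne_zero.2 hp) hcoeff

section Field

variable {K : Type*} [Field K] {T : K[X] →ₗ[K] K[X]} {c : ℕ → K}

theorem of_sequence (S : Polynomial.Sequence K) (h : ∀ n, T (S n) = c n • S n) :
    IsDegreeTriangular T c := by
  intro n
  suffices hle : degreeLT K (n + 1) ≤ (degreeLT K n).comap (T - c n • LinearMap.id) from
    hle (mem_degreeLT.2 ((degree_X_pow_le n).trans_lt (by exact_mod_cast n.lt_succ_self)))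
  rw [← S.span_degreeLT fun i _ => (leadingCoeff_ne_zero.2 (S.ne_zero i)).isUnit]
  refine Submodule.span_le.2 ?_
  rintro _ ⟨k, hk, rfl⟩
  change T (S k) - c n • S k ∈ degreeLT K n
  rw [h, ← sub_smul]
  rcases (Nat.lt_succ_iff.1 hk).eq_or_lt with rfl | hk
  · simp
  · exact Submodule.smul_mem _ _ (mem_degreeLT.2 (by rw [S.degree_eq]; exact_mod_cast hk))

theorem exists_monic_eigenvector (hT : IsDegreeTriangular T c) (hc : Function.Injective c)
    (n : ℕ) : ∃ p : K[X], p.Monic ∧ p.degree = n ∧ T p = c n • p := by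
  let A : K[X] →ₗ[K] K[X] := T - c n • LinearMap.id
  have hmaps : ∀ p ∈ degreeLT K n, A p ∈ degreeLT K n := fun p hp =>
    sub_mem (hT.map_mem_degreeLT hp) (Submodule.smul_mem _ _ hp)
  have hinj : Function.Injective (A.restrict hmaps) := by
    refine (injective_iff_map_eq_zero _).2 fun ⟨p, hp⟩ hker => Subtype.ext ?_
    by_contra hp0
    have heig : T p = c n • p := sub_eq_zero.1 (congrArg Subtype.val hker)
    have hlt := (natDegree_lt_iff_degree_lt hp0).2 (mem_degreeLT.1 hp)
    exact hlt.ne' (hc (hT.eigenvalue_eq hp0 heig))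
  have : FiniteDimensional K (degreeLT K n) := (degreeLTEquiv K n).symm.finiteDimensional
  obtain ⟨⟨r, hr⟩, hAr⟩ := LinearMap.surjective_of_injective hinj ⟨_, hT n⟩
  have hAr : T r - c n • r = T (X ^ n) - c n • X ^ n := congrArg Subtype.val hAr
  have hdeg := mem_degreeLT.1 hr
  refine ⟨X ^ n - r, monic_X_pow_sub hdeg, ?_, ?_⟩
  · rw [degree_sub_eq_left_of_degree_lt (by rwa [degree_X_pow]), degree_X_pow]
  · rw [map_sub, smul_sub]
    linear_combination -hAr

end Field

end IsDegreeTriangular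

theorem coeff_sum_iterate_derivative_X_pow_mul {R : Type*} [CommRing R] (f : ℕ → R[X]) (m n : ℕ) :
    (∑ j ∈ Finset.range m, derivative^[j] (X ^ n) * f j).coeff n =
      ∑ j ∈ Finset.range m, n.descFactorial j * (f j).coeff j := by
  rw [finsetSum_coeff]
  refine Finset.sum_congr rfl fun j _ => ?_
  rw [iterate_derivative_X_pow_eq_C_mul, mul_assoc, coeff_C_mul, coeff_X_pow_mul']
  rcases le_or_gt j n with hj | hj
  · rw [if_pos (n.sub_le j), Nat.sub_sub_self hj]
  · simp [Nat.descFactorial_eq_zero_iff_lt.2 hj]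

theorem isDegreeTriangular_of_natDegree_le {R : Type*} [CommRing R] {T : R[X] →ₗ[R] R[X]}
    {f : ℕ → R[X]} {m : ℕ} (hT : ∀ p, T p = ∑ j ∈ Finset.range m, derivative^[j] p * f j)
    (hf : ∀ j, (f j).natDegree ≤ j) :
    IsDegreeTriangular T fun n =>
      ∑ j ∈ Finset.range m, (n.descFactorial j : R) * (f j).coeff j := by
  intro n
  rw [mem_degreeLT, degree_lt_iff_coeff_zero, hT]
  intro k hk
  rw [coeff_sub, coeff_smul, coeff_X_pow]
  rcases hk.eq_or_lt with rfl | hk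
  · rw [coeff_sum_iterate_derivative_X_pow_mul, if_pos rfl, smul_eq_mul, mul_one, sub_self]
  rw [if_neg hk.ne', smul_zero, sub_zero, finsetSum_coeff]
  refine Finset.sum_eq_zero fun j _ => ?_
  rw [iterate_derivative_X_pow_eq_C_mul, mul_assoc, coeff_C_mul, coeff_X_pow_mul']
  rcases le_or_gt j n with hj | hj
  · rw [if_pos (by lia), coeff_eq_zero_of_natDegree_lt ((hf j).trans_lt (by lia)), mul_zero]
  · simp [Nat.descFactorial_eq_zero_iff_lt.2 hj]

theorem IsDegreeTriangular.exists_diagonal_eq_eval {R : Type*} [CommRing R] {T : R[X] →ₗ[R] R[X]}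
    {c : ℕ → R} (hc : IsDegreeTriangular T c) {f : ℕ → R[X]} {m : ℕ}
    (hT : ∀ p, T p = ∑ j ∈ Finset.range m, derivative^[j] p * f j) :
    ∃ q : R[X], ∀ n : ℕ, c n = q.eval (n : R) := by
  refine ⟨∑ j ∈ Finset.range m, descPochhammer R j * C ((f j).coeff j), fun n => ?_⟩
  rw [← hc.coeff_map_X_pow, hT, coeff_sum_iterate_derivative_X_pow_mul, eval_finsetSum]
  simp only [eval_mul, eval_C, descPochhammer_eval_eq_descFactorial]

section Hypergeometric

theorem iterate_derivative_hypergeometric {R : Type*} [CommRing R] {a b : R[X]}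
    (ha : a.natDegree ≤ 2) (hb : b.natDegree ≤ 1) (p : R[X]) (j : ℕ) :
    derivative^[j] (derivative (derivative p) * a + derivative p * b) =
      derivative^[j + 2] p * a + derivative^[j + 1] p * (j * derivative a + b) +
        derivative^[j] p * (j.choose 2 * derivative (derivative a) + j * derivative b) := by
  have ha' : derivative (derivative (derivative a)) = 0 :=
    iterate_derivative_eq_zero (x := 3) (by lia)
  have hb' : derivative (derivative b) = 0 := iterate_derivative_eq_zero (x := 2) (by lia)
  induction j with
  | zero => simp
  | succ j ih =>
    rw [Function.iterate_succ_apply', ih, Nat.choose_succ_succ' j 1, Nat.choose_one_right]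
    simp only [derivative_add, derivative_mul, derivative_natCast, ha', hb',
      ← Function.iterate_succ_apply' derivative]
    push_cast
    ring

variable {K : Type*} [Field K] {a b : K[X]} (ha : a.natDegree ≤ 2) (hb : b.natDegree ≤ 1)
  {x₀ : K} (hx₀ : a.eval x₀ = 0) (hne : ∀ j : ℕ, j * (derivative a).eval x₀ + b.eval x₀ ≠ 0)

include ha hb hx₀ hne

theorem exists_eval_iterate_derivative_eq (j : ℕ) :
    ∃ q : K[X], ∀ (p : K[X]) (l : K), derivative (derivative p) * a + derivative p * b = l • p →
      (derivative^[j] p).eval x₀ = q.eval l * p.eval x₀ := by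
  induction j with
  | zero => exact ⟨1, by simp⟩
  | succ j ih =>
    obtain ⟨q, hq⟩ := ih
    set s := j * (derivative a).eval x₀ + b.eval x₀ with hs
    set e := j.choose 2 * (derivative (derivative a)).eval x₀ + j * (derivative b).eval x₀ with he
    refine ⟨C s⁻¹ * (X - C e) * q, fun p l hp => ?_⟩
    have hrec : (derivative^[j + 1] p).eval x₀ * s = (l - e) * (derivative^[j] p).eval x₀ := by
      have h := congrArg (eval x₀) (iterate_derivative_hypergeometric ha hb p j)
      rw [hp, iterate_derivative_smul] at h
      simp only [eval_smul, eval_add, eval_mul, eval_natCast, hx₀, smul_eq_mul, mul_zero,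
        zero_add, ← hs, ← he] at h
      linear_combination -h
    rw [eq_div_of_mul_eq (hne j) hrec, hq p l hp]
    simp only [eval_mul, eval_C, eval_sub, eval_X]
    ring

theorem eval_ne_zero_of_hypergeometric [CharZero K] {p : K[X]} (hp₀ : p ≠ 0) {l : K}
    (hp : derivative (derivative p) * a + derivative p * b = l • p) : p.eval x₀ ≠ 0 := by
  intro h0
  refine hp₀ (eq_zero_of_hasseDeriv_eq_zero p x₀ fun k => ?_)
  obtain ⟨q, hq⟩ := exists_eval_iterate_derivative_eq ha hb hx₀ hne k
  have h : (k.factorial • hasseDeriv k p).eval x₀ = 0 := by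
    rw [← LinearMap.smul_apply, factorial_smul_hasseDeriv, hq p l hp, h0, mul_zero]
  simpa [eval_smul, k.factorial_ne_zero] using h

theorem exists_eigenvalue_eq_eval [CharZero K] (f : ℕ → K[X]) (m : ℕ) :
    ∃ q : K[X], ∀ (p : K[X]) (l μ : K), p ≠ 0 →
      derivative (derivative p) * a + derivative p * b = l • p →
      ∑ j ∈ Finset.range m, derivative^[j] p * f j = μ • p → μ = q.eval l := by
  choose q hq using exists_eval_iterate_derivative_eq ha hb hx₀ hne
  refine ⟨∑ j ∈ Finset.range m, q j * C ((f j).eval x₀), fun p l μ hp₀ hp hμ => ?_⟩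
  refine mul_right_cancel₀ (eval_ne_zero_of_hypergeometric ha hb hx₀ hne hp₀ hp) ?_
  have h := congrArg (eval x₀) hμ
  rw [eval_smul, smul_eq_mul] at h
  rw [← h]
  simp only [eval_finsetSum, eval_mul, eval_C, hq _ p l hp, Finset.sum_mul]
  exact Finset.sum_congr rfl fun j _ => by ring

end Hypergeometric

theorem eq_zero_of_X_mul_comp_eq_comp {R : Type*} [CommRing R] [IsDomain R] {g : R[X]}
    (hg : Even g.natDegree) (hg₀ : g.natDegree ≠ 0) {q r : R[X]}
    (h : X * q.comp g = r.comp g) : q = 0 := by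
  by_contra hq
  have hq' : q.comp g ≠ 0 := by
    rw [Ne, comp_eq_zero_iff]
    rintro (h | ⟨-, h⟩)
    · exact hq h
    · exact hg₀ (by rw [h, natDegree_C])
  have hdeg := congrArg natDegree h
  rw [natDegree_mul X_ne_zero hq', natDegree_X, natDegree_comp, natDegree_comp] at hdeg
  obtain ⟨k, hk⟩ := hg
  rw [hk] at hdeg
  have : 2 * (r.natDegree * k) = 1 + 2 * (q.natDegree * k) := by linarith
  lia

/-- With `g = -X (X + s)` the hypothesis reads `n (s - s') q(g(n)) = r(g(n)) - g(n) q(g(n))`, where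
the left side has odd degree in `n` unless `s = s'`. -/
theorem eq_of_quadratic_mul_eval_eq_eval {K : Type*} [Field K] [CharZero K] {s s' : K} {q r : K[X]}
    (hq : q ≠ 0)
    (h : ∀ n : ℕ, -n * (n + s') * q.eval (-n * (n + s)) = r.eval (-n * (n + s))) : s = s' := by
  by_contra hne
  set g : K[X] := -(X * (X + C s)) with hg
  have hg_eval : ∀ n : ℕ, g.eval (n : K) = -n * (n + s) := fun n => by simp [hg]
  have hg_deg : g.natDegree = 2 := by
    rw [hg, natDegree_neg, natDegree_X_mul (X_add_C_ne_zero s), natDegree_X_add_C]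
  have hcomp : X * (C (s - s') * q).comp g = (r - X * q).comp g := by
    refine Polynomial.eq_of_infinite_eval_eq _ _ ((Set.infinite_range_of_injective
      (Nat.cast_injective (R := K))).mono ?_)
    rintro _ ⟨n, rfl⟩
    simp only [Set.mem_ofPred_eq, eval_mul, eval_comp, eval_X, eval_C, eval_sub, hg_eval, ← h]
    ring
  have hzero := eq_zero_of_X_mul_comp_eq_comp (by rw [hg_deg]; exact even_two)
    (by rw [hg_deg]; exact two_ne_zero) hcomp
  exact (mul_eq_zero.1 hzero).elim (C_ne_zero.2 (sub_ne_zero.2 hne)) hq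

end Polynomials

namespace WeylAlgebra

theorem act_add (p : ℂ[X]) (D E : WeylAlgebra) : act p (D + E) = act p D + act p E := (rfl)

theorem act_sub (p : ℂ[X]) (D E : WeylAlgebra) : act p (D - E) = act p D - act p E := (rfl)

theorem act_mul (p : ℂ[X]) (D E : WeylAlgebra) : act p (D * E) = act (act p D) E := (rfl)

theorem act_zero (p : ℂ[X]) : act p 0 = 0 := (rfl)

theorem act_one (p : ℂ[X]) : act p 1 = p := (rfl)

theorem act_algebraMap (p : ℂ[X]) (c : ℂ) : act p (algebraMap ℂ WeylAlgebra c) = c • p := (rfl)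

theorem act_dx (p : ℂ[X]) : act p dx = derivative p := (rfl)

theorem act_mulBy (p f : ℂ[X]) : act p (mulBy f) = p * f := (rfl)

theorem smul_act (c : ℂ) (p : ℂ[X]) (D : WeylAlgebra) : act (c • p) D = c • act p D :=
  map_smul _ c p

/-- The right action of `D` as an endomorphism of `ℂ[X]`; it reverses products. -/
def toEnd (D : WeylAlgebra) : Module.End ℂ ℂ[X] := (D : (Module.End ℂ ℂ[X])ᵐᵒᵖ).unop

theorem toEnd_apply (D : WeylAlgebra) (p : ℂ[X]) : toEnd D p = act p D := (rfl)

theorem ext_sequence (S : Polynomial.Sequence ℂ) {D E : WeylAlgebra}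
    (h : ∀ n, act (S n) D = act (S n) E) : D = E := by
  have hunit : ∀ n, IsUnit (S n).leadingCoeff := fun n =>
    (leadingCoeff_ne_zero.2 (S.ne_zero n)).isUnit
  refine Subtype.ext (MulOpposite.unop_injective ((S.basis hunit).ext fun n => ?_))
  rw [S.basis_eq_self]
  exact h n

theorem exists_act_eq_sum (D : WeylAlgebra) : ∃ (m : ℕ) (f : ℕ → ℂ[X]), ∀ p : ℂ[X],
    act p D = ∑ j ∈ Finset.range m, derivative^[j] p * f j := D.2

theorem act_aeval {p : ℂ[X]} {D : WeylAlgebra} {c : ℂ} (h : act p D = c • p) (q : ℂ[X]) :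
    act p (aeval D q) = q.eval c • p := by
  have hpow : ∀ n : ℕ, act p (D ^ n) = c ^ n • p := by
    intro n
    induction n with
    | zero => rw [pow_zero, pow_zero, act_one, one_smul]
    | succ n ih => rw [pow_succ, act_mul, ih, smul_act, h, smul_smul, pow_succ]
  induction q using Polynomial.induction_on' with
  | add a b ha hb => rw [map_add, act_add, ha, hb, eval_add, add_smul]
  | monomial n a =>
    rw [aeval_monomial, act_mul, act_algebraMap, smul_act, hpow, eval_monomial, smul_smul]

end WeylAlgebra

namespace ClassicalWeight

open WeylAlgebra

variable {t : ClassicalType} (w : ClassicalWeight t)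

section Eigenpolynomials

/-- The coefficient of `∂²` in `δ`. -/
def lead : {t : ClassicalType} → ClassicalWeight t → ℂ[X]
  | _, hermite _ => 1
  | _, laguerre _ _ => X
  | _, jacobi _ _ _ _ => 1 - X ^ 2

/-- The coefficient of `∂` in `δ`. -/
def drift : {t : ClassicalType} → ClassicalWeight t → ℂ[X]
  | _, hermite b => -2 * (X - C (b : ℂ))
  | _, laguerre α _ => C ((α : ℂ) + 1) - X
  | _, jacobi α β _ _ => C ((β : ℂ) - α) - X * C ((α : ℂ) + β + 2)

theorem act_delta (p : ℂ[X]) :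
    act p w.delta = derivative (derivative p) * w.lead + derivative p * w.drift := by
  cases w with
  | hermite b =>
    have act_two : ∀ q, act q 2 = 2 * q := fun q => by
      rw [← one_add_one_eq_two, act_add, act_one, two_mul]
    simp only [delta, pow_two, act_sub, act_mul, act_dx, act_mulBy, act_two, lead, drift,
      derivative_mul, derivative_ofNat]
    ring
  | laguerre α hα => simp only [delta, pow_two, act_add, act_mul, act_dx, act_mulBy, lead, drift]
  | jacobi α β hα hβ =>
    simp only [delta, pow_two dx, act_add, act_mul, act_dx, act_mulBy, lead, drift]

theorem natDegree_lead_le : w.lead.natDegree ≤ 2 := by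
  cases w <;> simp only [lead] <;> compute_degree <;> norm_num

theorem natDegree_drift_le : w.drift.natDegree ≤ 1 := by
  cases w <;> simp only [drift] <;> compute_degree

/-- The eigenvalue of `δ` on polynomials of degree `n`. -/
def eigenvalue : {t : ClassicalType} → ClassicalWeight t → ℕ → ℂ
  | _, hermite _, n => -2 * n
  | _, laguerre _ _, n => -n
  | _, jacobi α β _ _, n => -n * (n + (α + β + 1))

theorem eigenvalue_injective : Function.Injective w.eigenvalue := by
  intro m n h
  cases w with
  | hermite b => simpa [eigenvalue] using h
  | laguerre α hα => simpa [eigenvalue] using h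
  | jacobi α β hα hβ =>
    by_contra hmn
    have hprod : ((m : ℝ) - n) * (m + n + (α + β + 1)) = 0 := by
      have : ((m : ℂ) - n) * (m + n + (α + β + 1)) = 0 := by
        simp only [eigenvalue] at h
        linear_combination -h
      exact_mod_cast this
    have hpos : (1 : ℝ) ≤ m + n := by exact_mod_cast (by lia : 1 ≤ m + n)
    rcases mul_eq_zero.1 hprod with hzero | hzero
    · exact hmn (by exact_mod_cast sub_eq_zero.1 hzero)
    · linarith

theorem eigenvalue_eq_coeff (n : ℕ) :
    w.eigenvalue n = n * (n - 1) * w.lead.coeff 2 + n * w.drift.coeff 1 := by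
  have hC : ∀ c : ℂ, (C c).coeff 1 = 0 := fun c => coeff_C_of_ne_zero one_ne_zero
  cases w with
  | hermite b => simp [eigenvalue, lead, drift, hC, coeff_one, ← C_ofNat, mul_comm]
  | laguerre α hα => simp [eigenvalue, lead, drift, hC, coeff_X, -map_add]
  | jacobi α β hα hβ =>
    simp only [eigenvalue, lead, drift, coeff_sub, coeff_one, coeff_X_pow, coeff_mul_C, coeff_X,
      hC]
    norm_num
    ring

theorem isDegreeTriangular_delta : IsDegreeTriangular (toEnd w.delta) w.eigenvalue := by
  let f : ℕ → ℂ[X] := fun j => if j = 1 then w.drift else if j = 2 then w.lead else 0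
  have hsum : ∀ p, toEnd w.delta p = ∑ j ∈ Finset.range 3, derivative^[j] p * f j := fun p => by
    simp [f, Finset.sum_range_succ, toEnd_apply, act_delta, add_comm]
  have hdeg : ∀ j, (f j).natDegree ≤ j := by
    intro j
    dsimp only [f]
    split_ifs with h₁ h₂
    · exact h₁ ▸ w.natDegree_drift_le
    · exact h₂ ▸ w.natDegree_lead_le
    · simp
  have hdiag : w.eigenvalue = fun n =>
      ∑ j ∈ Finset.range 3, (n.descFactorial j : ℂ) * (f j).coeff j := by
    ext n
    rw [eigenvalue_eq_coeff, Finset.sum_range_succ, Nat.cast_descFactorial_two]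
    simp [f, Finset.sum_range_succ, add_comm]
  rw [hdiag]
  exact isDegreeTriangular_of_natDegree_le hsum hdeg

theorem exists_monic_eigensequence : ∃ S : Polynomial.Sequence ℂ,
    (∀ n, (S n).Monic) ∧ ∀ n, act (S n) w.delta = w.eigenvalue n • S n := by
  choose p hmonic hdegree heig using
    w.isDegreeTriangular_delta.exists_monic_eigenvector w.eigenvalue_injective
  exact ⟨⟨p, hdegree⟩, hmonic, heig⟩

/-- The monic eigenpolynomials of `δ`, one in each degree. They are the monic orthogonal
polynomials of the weight. -/
def opoly : Polynomial.Sequence ℂ := w.exists_monic_eigensequence.choose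

theorem opoly_monic (n : ℕ) : (w.opoly n).Monic := w.exists_monic_eigensequence.choose_spec.1 n

theorem act_opoly_delta (n : ℕ) : act (w.opoly n) w.delta = w.eigenvalue n • w.opoly n :=
  w.exists_monic_eigensequence.choose_spec.2 n

theorem coeff_opoly_self (n : ℕ) : (w.opoly n).coeff n = 1 := by
  simpa using (w.opoly_monic n).coeff_natDegree

end Eigenpolynomials

end ClassicalWeight

theorem eval_map_conj_ofReal (p : ℂ[X]) (x : ℝ) :
    (p.map conj).eval (x : ℂ) = conj (p.eval (x : ℂ)) := by
  simpa only [Complex.conj_ofReal] using eval_map_apply (p := p) conj (x : ℂ)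

theorem eq_zero_of_eval_ofReal_eq_zero {p : ℂ[X]} {I : Set ℝ} (hI : I.Infinite)
    (h : ∀ x ∈ I, p.eval (x : ℂ) = 0) : p = 0 := by
  refine eq_zero_of_infinite_isRoot p ((hI.image Complex.ofReal_injective.injOn).mono ?_)
  rintro _ ⟨x, hx, rfl⟩
  exact h x hx

theorem hasDerivAt_exp_neg_sq_add (b x : ℝ) :
    HasDerivAt (fun x : ℝ => Real.exp (-x ^ 2 + 2 * b * x))
      (-2 * (x - b) * Real.exp (-x ^ 2 + 2 * b * x)) x := by
  convert! (((hasDerivAt_pow 2 x).neg).add ((hasDerivAt_id x).const_mul (2 * b))).exp using 1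
  simp only [Pi.add_apply, Pi.neg_apply, id]
  push_cast
  ring

theorem hasDerivAt_mul_exp_neg_mul_rpow (α : ℝ) {x : ℝ} (hx : x ≠ 0) :
    HasDerivAt (fun x : ℝ => x * (Real.exp (-x) * x ^ α))
      ((α + 1 - x) * (Real.exp (-x) * x ^ α)) x := by
  convert! (hasDerivAt_id x).mul (((hasDerivAt_id x).neg.exp).mul
    (Real.hasDerivAt_rpow_const (p := α) (Or.inl hx))) using 1
  simp only [Pi.mul_apply, Pi.neg_apply, id, Real.rpow_sub_one hx]
  field_simp
  ring

theorem hasDerivAt_one_sub_sq_mul_rpow_mul_rpow (α β : ℝ) {x : ℝ} (hx : 1 - x ≠ 0)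
    (hx' : 1 + x ≠ 0) :
    HasDerivAt (fun x : ℝ => (1 - x ^ 2) * ((1 - x) ^ α * (1 + x) ^ β))
      ((β - α - x * (α + β + 2)) * ((1 - x) ^ α * (1 + x) ^ β)) x := by
  convert! ((hasDerivAt_pow 2 x).const_sub 1).mul
    ((((hasDerivAt_id x).const_sub 1).rpow_const (p := α) (Or.inl hx)).mul
    (((hasDerivAt_id x).const_add 1).rpow_const (p := β) (Or.inl hx'))) using 1
  simp only [Pi.mul_apply, id, Real.rpow_sub_one hx, Real.rpow_sub_one hx']
  push_cast
  field_simp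
  ring

namespace ClassicalWeight

open WeylAlgebra

variable {t : ClassicalType} (w : ClassicalWeight t)

section Moment

theorem integrableOn_eval_mul_fn (f : ℂ[X]) :
    IntegrableOn (fun x : ℝ => f.eval (x : ℂ) * (w.fn x : ℂ)) t.interval := by
  induction f using Polynomial.induction_on' with
  | add p q hp hq =>
    simp only [eval_add, add_mul]
    exact hp.add hq
  | monomial n a =>
    have h := ((w.fn_moments n).ofReal (𝕜 := ℂ)).const_mul a
    refine h.congr (Filter.Eventually.of_forall fun x => ?_)
    simp [mul_assoc]

/-- The linear functional `f ↦ ∫ f w`. -/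
def moment : ℂ[X] →ₗ[ℂ] ℂ where
  toFun f := ∫ x in t.interval, f.eval (x : ℂ) * (w.fn x : ℂ)
  map_add' f g := by
    simp only [eval_add, add_mul]
    exact integral_add (w.integrableOn_eval_mul_fn f) (w.integrableOn_eval_mul_fn g)
  map_smul' c f := by
    simp only [eval_smul, smul_eq_mul, mul_assoc, RingHom.id_apply]
    exact integral_const_mul c _

theorem moment_apply (f : ℂ[X]) :
    w.moment f = ∫ x in t.interval, f.eval (x : ℂ) * (w.fn x : ℂ) := (rfl)

theorem eq_zero_of_moment_mul_conj {f : ℂ[X]} (h : w.moment (f * f.map conj) = 0) : f = 0 := by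
  set F : ℝ → ℝ := fun x => ‖f.eval (x : ℂ)‖ ^ 2 * w.fn x with hF
  have heq : ∀ x : ℝ, (f * f.map conj).eval (x : ℂ) * (w.fn x : ℂ) = (F x : ℂ) := fun x => by
    rw [eval_mul, eval_map_conj_ofReal, Complex.mul_conj, Complex.normSq_eq_norm_sq, hF]
    push_cast
    rfl
  have hmeas := (isOpen_interval t).measurableSet
  have hint : IntegrableOn F t.interval := by
    refine (w.integrableOn_eval_mul_fn (f * f.map conj)).re.congr ?_
    exact Filter.Eventually.of_forall fun x => by simp only [heq]; exact Complex.ofReal_re _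
  have hcont : ContinuousOn F t.interval :=
    ContinuousOn.mul (by fun_prop) w.fn_smooth.continuousOn
  have hnonneg : 0 ≤ᵐ[volume.restrict t.interval] F :=
    ae_restrict_of_forall_mem hmeas fun x hx => mul_nonneg (sq_nonneg _) (w.fn_pos hx).le
  simp only [moment_apply, heq] at h
  rw [integral_complex_ofReal, Complex.ofReal_eq_zero,
    setIntegral_eq_zero_iff_of_nonneg_ae hnonneg hint] at h
  have hzero : Set.EqOn F 0 t.interval :=
    Measure.eqOn_open_of_ae_eq h (isOpen_interval t) hcont continuousOn_const
  obtain ⟨x₀, hx₀⟩ := nonempty_interval t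
  have hinf : t.interval.Infinite := infinite_of_mem_nhds x₀ ((isOpen_interval t).mem_nhds hx₀)
  refine eq_zero_of_eval_ofReal_eq_zero hinf fun x hx => ?_
  have hFx : ‖f.eval (x : ℂ)‖ ^ 2 * w.fn x = 0 := hzero hx
  simpa [(w.fn_pos hx).ne'] using hFx

theorem hasDerivAt_lead_mul_fn {x : ℝ} (hx : x ∈ t.interval) :
    HasDerivAt (fun x : ℝ => w.lead.eval (x : ℂ) * (w.fn x : ℂ))
      (w.drift.eval (x : ℂ) * (w.fn x : ℂ)) x := by
  cases w with
  | hermite b => simpa [lead, drift, fn] using (hasDerivAt_exp_neg_sq_add b x).ofReal_comp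
  | laguerre α hα =>
    have hx₀ : 0 < x := hx
    simpa [lead, drift, fn] using (hasDerivAt_mul_exp_neg_mul_rpow α hx₀.ne').ofReal_comp
  | jacobi α β hα hβ =>
    have h₁ : 0 < 1 - x := by linarith [hx.2]
    have h₂ : 0 < 1 + x := by linarith [hx.1]
    simpa [lead, drift, fn] using
      (hasDerivAt_one_sub_sq_mul_rpow_mul_rpow α β h₁.ne' h₂.ne').ofReal_comp

theorem continuousOn_lead_mul_fn :
    ContinuousOn (fun x : ℝ => w.lead.eval (x : ℂ) * (w.fn x : ℂ)) (closure t.interval) := by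
  cases w with
  | hermite b =>
    simp only [lead, fn]
    fun_prop
  | laguerre α hα =>
    have hrpow : Continuous fun x : ℝ => x ^ (α + 1) := Real.continuous_rpow_const (by linarith)
    have hcont : Continuous fun x : ℝ => ((Real.exp (-x) * x ^ (α + 1) : ℝ) : ℂ) := by fun_prop
    refine hcont.continuousOn.congr fun x hx => ?_
    have hx₀ : 0 ≤ x := by simpa [ClassicalType.interval, closure_Ioi] using hx
    beta_reduce
    rw [Real.rpow_add_one' hx₀ (by linarith)]
    simp only [lead, fn, eval_X]
    push_cast
    ring
  | jacobi α β hα hβ =>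
    have hα' : Continuous fun x : ℝ => x ^ (α + 1) := Real.continuous_rpow_const (by linarith)
    have hβ' : Continuous fun x : ℝ => x ^ (β + 1) := Real.continuous_rpow_const (by linarith)
    have hcont : Continuous fun x : ℝ => (((1 - x) ^ (α + 1) * (1 + x) ^ (β + 1) : ℝ) : ℂ) :=
      Complex.continuous_ofReal.comp ((hα'.comp (continuous_const.sub continuous_id)).mul
        (hβ'.comp (continuous_const.add continuous_id)))
    refine hcont.continuousOn.congr fun x hx => ?_
    obtain ⟨h₁, h₂⟩ : -1 ≤ x ∧ x ≤ 1 := by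
      simpa [ClassicalType.interval, closure_Ioo (show (-1 : ℝ) ≠ 1 by norm_num)] using hx
    beta_reduce
    rw [Real.rpow_add_one' (by linarith) (by linarith),
      Real.rpow_add_one' (by linarith) (by linarith)]
    simp only [lead, fn, eval_sub, eval_one, eval_pow, eval_X]
    push_cast
    ring

theorem moment_pearson (r : ℂ[X]) : w.moment (derivative r * w.lead + r * w.drift) = 0 := by
  set F : ℝ → ℂ := fun x => r.eval (x : ℂ) * (w.lead.eval (x : ℂ) * (w.fn x : ℂ)) with hF
  set F' : ℝ → ℂ := fun x =>
    (derivative r * w.lead + r * w.drift).eval (x : ℂ) * (w.fn x : ℂ) with hF'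
  have hderiv : ∀ x ∈ t.interval, HasDerivAt F (F' x) x := fun x hx => by
    convert! (r.hasDerivAt (x : ℂ)).comp_ofReal.mul (w.hasDerivAt_lead_mul_fn hx) using 1
    simp only [hF', eval_add, eval_mul]
    ring
  have hcont : ContinuousOn F (closure t.interval) :=
    ContinuousOn.mul (by fun_prop) w.continuousOn_lead_mul_fn
  have hint : IntegrableOn F t.interval := by
    simpa only [eval_mul, mul_assoc] using w.integrableOn_eval_mul_fn (r * w.lead)
  have hint' : IntegrableOn F' t.interval := w.integrableOn_eval_mul_fn _
  change ∫ x in t.interval, F' x = 0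
  cases w with
  | hermite b =>
    simp only [ClassicalType.interval, setIntegral_univ, integrableOn_univ] at hint hint' ⊢
    exact integral_eq_zero_of_hasDerivAt_of_integrable (fun x => hderiv x trivial) hint' hint
  | laguerre α hα =>
    have hcont₀ : ContinuousWithinAt F (Set.Ici 0) 0 := by
      simpa [ClassicalType.interval, closure_Ioi] using hcont 0 (by simp [ClassicalType.interval])
    refine (integral_Ioi_of_hasDerivAt_of_tendsto hcont₀ hderiv hint'
      (tendsto_zero_of_hasDerivAt_of_integrableOn_Ioi hderiv hint' hint)).trans ?_
    simp [hF, lead]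
  | jacobi α β hα hβ =>
    have hle : (-1 : ℝ) ≤ 1 := by norm_num
    rw [ClassicalType.interval, closure_Ioo (by norm_num)] at hcont
    rw [ClassicalType.interval, ← integral_Ioc_eq_integral_Ioo,
      ← intervalIntegral.integral_of_le hle,
      intervalIntegral.integral_eq_sub_of_hasDerivAt_of_le hle hcont hderiv
        ((intervalIntegrable_iff_integrableOn_Ioo_of_le hle).2 hint')]
    simp [hF, lead]

theorem moment_act_delta_mul (p q : ℂ[X]) :
    w.moment (act p w.delta * q) = w.moment (p * act q w.delta) := by
  have hsub : act p w.delta * q - p * act q w.delta =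
      derivative (derivative p * q - p * derivative q) * w.lead +
        (derivative p * q - p * derivative q) * w.drift := by
    simp only [act_delta, derivative_sub, derivative_mul]
    ring
  rw [← sub_eq_zero, ← map_sub, hsub, moment_pearson]

theorem map_conj_act_delta (p : ℂ[X]) :
    (act p w.delta).map conj = act (p.map conj) w.delta := by
  have hlead : w.lead.map conj = w.lead := by cases w <;> simp [lead]
  have hdrift : w.drift.map conj = w.drift := by cases w <;> simp [drift, Complex.conj_ofNat]
  simp only [act_delta, derivative_map, Polynomial.map_add, Polynomial.map_mul, hlead, hdrift]

theorem conj_eigenvalue (n : ℕ) : conj (w.eigenvalue n) = w.eigenvalue n := by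
  cases w <;> simp [eigenvalue, Complex.conj_ofNat]

theorem moment_opoly_mul_conj_opoly {m n : ℕ} (h : m ≠ n) :
    w.moment (w.opoly m * (w.opoly n).map conj) = 0 := by
  have hsymm := w.moment_act_delta_mul (w.opoly m) ((w.opoly n).map conj)
  rw [← map_conj_act_delta, act_opoly_delta, act_opoly_delta, Polynomial.map_smul,
    conj_eigenvalue, smul_mul_assoc, mul_smul_comm, map_smul, map_smul, smul_eq_mul,
    smul_eq_mul] at hsymm
  by_contra hne
  exact h (w.eigenvalue_injective (mul_right_cancel₀ hne hsymm))

theorem eq_zero_of_orthogonal {r : ℂ[X]} {n : ℕ} (hr : r.degree < n)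
    (h : ∀ m < n, w.moment (r * (w.opoly m).map conj) = 0) : r = 0 := by
  refine w.eq_zero_of_moment_mul_conj ?_
  have hspan := w.opoly.span_degreeLT (m := n) fun i _ => by simp [(w.opoly_monic i).leadingCoeff]
  suffices H : ∀ s ∈ Submodule.span ℂ (w.opoly '' Set.Iio n), w.moment (r * s.map conj) = 0 from
    H r (hspan ▸ mem_degreeLT.2 hr)
  intro s hs
  induction hs using Submodule.span_induction with
  | mem s hs =>
    obtain ⟨m, hm, rfl⟩ := hs
    exact h m hm
  | zero => simp
  | add s u _ _ hs hu => rw [Polynomial.map_add, mul_add, map_add, hs, hu, add_zero]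
  | smul c s _ hs => rw [Polynomial.map_smul, mul_smul_comm, map_smul, hs, smul_zero]

end Moment

end ClassicalWeight

namespace ClassicalWeight

open WeylAlgebra

variable {t : ClassicalType}

/-- `V` maps the orthogonal polynomials of `w` to those of `w'`, with coefficients `a`. For a
diagonal weight these are the entries of the operators in its algebra. -/
def Intertwines (w w' : ClassicalWeight t) (V : WeylAlgebra) (a : ℕ → ℂ) : Prop :=
  ∀ n, act (w.opoly n) V = a n • w'.opoly n

namespace Intertwines

variable {w w' w'' : ClassicalWeight t} {U V : WeylAlgebra} {a b : ℕ → ℂ}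

theorem ext (hU : Intertwines w w' U a) (hV : Intertwines w w' V a) : U = V :=
  ext_sequence w.opoly fun n => (hU n).trans (hV n).symm

theorem coeff_unique (ha : Intertwines w w' V a) (hb : Intertwines w w' V b) : a = b :=
  funext fun n => smul_left_injective ℂ (w'.opoly.ne_zero n) ((ha n).symm.trans (hb n))

theorem zero : Intertwines w w' 0 0 := fun n => by rw [act_zero, Pi.zero_apply, zero_smul]

theorem mul (hU : Intertwines w w' U a) (hV : Intertwines w' w'' V b) :
    Intertwines w w'' (U * V) (a * b) := fun n => by
  rw [act_mul, hU, smul_act, hV, smul_smul, Pi.mul_apply]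

theorem of_mul_left (hU : Intertwines w w' U a) (ha : ∀ n, a n ≠ 0)
    (hUV : Intertwines w w'' (U * V) b) : Intertwines w' w'' V (a⁻¹ * b) := fun n => by
  have h := hUV n
  rw [act_mul, hU, smul_act] at h
  rw [Pi.mul_apply, mul_smul, ← h, Pi.inv_apply, inv_smul_smul₀ (ha n)]

theorem delta (w : ClassicalWeight t) : Intertwines w w w.delta w.eigenvalue := w.act_opoly_delta

theorem aeval_delta (w : ClassicalWeight t) (q : ℂ[X]) :
    Intertwines w w (aeval w.delta q) fun n => q.eval (w.eigenvalue n) := fun n =>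
  act_aeval (w.act_opoly_delta n) q

theorem isDegreeTriangular (hV : Intertwines w w V a) : IsDegreeTriangular (toEnd V) a :=
  .of_sequence w.opoly hV

theorem exists_coeff_eq_eval_of_singular {x₀ : ℂ} (hx₀ : w.lead.eval x₀ = 0)
    (hne : ∀ j : ℕ, j * (derivative w.lead).eval x₀ + w.drift.eval x₀ ≠ 0)
    (hV : Intertwines w w V a) : ∃ q : ℂ[X], ∀ n, a n = q.eval (w.eigenvalue n) := by
  obtain ⟨m, f, hf⟩ := exists_act_eq_sum V
  obtain ⟨q, hq⟩ :=
    exists_eigenvalue_eq_eval w.natDegree_lead_le w.natDegree_drift_le hx₀ hne f m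
  refine ⟨q, fun n => hq (w.opoly n) _ _ (w.opoly.ne_zero n) ?_ ?_⟩
  · rw [← act_delta, act_opoly_delta]
  · rw [← hf, hV]

theorem exists_coeff_eq_eval (hV : Intertwines w w V a) :
    ∃ q : ℂ[X], ∀ n, a n = q.eval (w.eigenvalue n) := by
  have hpos : ∀ (j : ℕ) {α : ℝ}, -1 < α → (α : ℂ) + 1 + j ≠ 0 := fun j α hα => by
    have : α + 1 + j ≠ 0 := by linarith [j.cast_nonneg (α := ℝ)]
    exact_mod_cast this
  cases w with
  | hermite b =>
    obtain ⟨m, f, hf⟩ := exists_act_eq_sum V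
    obtain ⟨q, hq⟩ := hV.isDegreeTriangular.exists_diagonal_eq_eval hf
    refine ⟨q.comp (C (-1 / 2) * X), fun n => ?_⟩
    rw [hq, eval_comp, eval_C_mul, eval_X, eigenvalue]
    ring_nf
  | laguerre α hα =>
    refine exists_coeff_eq_eval_of_singular (x₀ := 0) (by simp [lead]) (fun j => ?_) hV
    convert hpos j hα using 1
    simp only [lead, drift, derivative_X, eval_one, eval_sub, eval_C, eval_X]
    ring
  | jacobi α β hα hβ =>
    refine exists_coeff_eq_eval_of_singular (x₀ := 1) (by simp [lead]) (fun j => ?_) hV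
    convert mul_ne_zero (by norm_num : (-2 : ℂ) ≠ 0) (hpos j hα) using 1
    simp only [lead, drift, derivative_sub, derivative_one, derivative_X_pow, eval_sub, eval_mul,
      eval_C, eval_X, eval_pow, eval_zero]
    push_cast
    ring

theorem exists_eq_aeval_delta (hV : Intertwines w w V a) : ∃ q : ℂ[X], V = aeval w.delta q := by
  obtain ⟨q, hq⟩ := hV.exists_coeff_eq_eval
  exact ⟨q, hV.ext (by simpa only [← hq] using aeval_delta w q)⟩

theorem aeval_delta_mul (h : w.eigenvalue = w'.eigenvalue) (hV : Intertwines w w' V a)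
    (p : ℂ[X]) : aeval w.delta p * V = V * aeval w'.delta p := by
  refine ((aeval_delta w p).mul hV).ext ?_
  rw [h, mul_comm]
  exact hV.mul (aeval_delta w' p)

theorem eigenvalue_eq (hU : Intertwines w w' U a) (hV : Intertwines w' w V b)
    (hab : a * b ≠ 0) : w.eigenvalue = w'.eigenvalue := by
  obtain ⟨q, hq⟩ := (hU.mul hV).exists_coeff_eq_eval
  obtain ⟨r, hr⟩ := ((hU.mul (delta w')).mul hV).exists_coeff_eq_eval
  have hqr : ∀ n, w'.eigenvalue n * q.eval (w.eigenvalue n) = r.eval (w.eigenvalue n) :=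
    fun n => by
      rw [← hq, ← hr]
      simp only [Pi.mul_apply]
      ring
  have hq₀ : q ≠ 0 := by
    rintro rfl
    exact hab (funext fun n => by rw [hq, eval_zero, Pi.zero_apply])
  cases w with
  | hermite b => cases w'; rfl
  | laguerre α hα => cases w'; rfl
  | jacobi α β hα hβ =>
    obtain _ | _ | ⟨α', β', hα', hβ'⟩ := w'
    have hs := eq_of_quadratic_mul_eval_eq_eval hq₀ hqr
    exact funext fun n => congrArg (fun s : ℂ => -(n : ℂ) * (n + s)) hs

end Intertwines

end ClassicalWeight

theorem WeightMatrix.mem_center {I : Set ℝ} {ι : Type*} [Fintype ι] [DecidableEq ι]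
    {W : WeightMatrix I ι} {D : Matrix ι ι WeylAlgebra} :
    D ∈ W.center ↔ D ∈ W.diffAlgebra ∧ ∀ E ∈ W.diffAlgebra, Commute E D := by
  constructor
  · rintro ⟨D, hD, rfl⟩
    exact ⟨D.2, fun E hE => congrArg Subtype.val (Subalgebra.mem_center_iff.1 hD ⟨E, hE⟩)⟩
  · rintro ⟨hD, hcomm⟩
    exact ⟨⟨D, hD⟩, Subalgebra.mem_center_iff.2 fun E => Subtype.ext (hcomm E E.2), rfl⟩

theorem WeightMatrix.IsMonicOrthogonal.degree_sub_lt {I : Set ℝ} {ι : Type*} [Fintype ι]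
    [DecidableEq ι] {W : WeightMatrix I ι} {P Q : ℕ → Matrix ι ι ℂ[X]}
    (hP : W.IsMonicOrthogonal P) (hQ : W.IsMonicOrthogonal Q) (n : ℕ) (i j : ι) :
    (P n i j - Q n i j).degree < n := by
  rw [degree_lt_iff_coeff_zero]
  intro m hm
  rw [coeff_sub, sub_eq_zero]
  rcases hm.eq_or_lt with rfl | hm
  · exact congrFun₂ ((hP.monic n).trans (hQ.monic n).symm) i j
  · exact congrFun₂ ((hP.degree_le n m hm).trans (hQ.degree_le n m hm).symm) i j

namespace ClassicalWeight

open WeylAlgebra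

variable {t : ClassicalType} {ι : Type*} [Fintype ι] [DecidableEq ι] {w : ι → ClassicalWeight t}

theorem form_directSum_apply (w : ι → ClassicalWeight t) (P Q : Matrix ι ι ℂ[X]) (i j : ι) :
    (directSum w).form P Q i j = ∑ k, (w k).moment (P i k * (Q j k).map conj) := by
  simp only [WeightMatrix.form, moment_apply, Matrix.of_apply]
  rw [← integral_finsetSum _ fun k _ => (w k).integrableOn_eval_mul_fn _]
  congr 1
  ext x
  rw [Matrix.mul_apply]
  simp only [directSum, Matrix.mul_diagonal, Matrix.map_apply, Matrix.conjTranspose_apply,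
    eval_mul, eval_map_conj_ofReal, starRingEnd_apply, mul_right_comm]

/-- The monic orthogonal polynomials of a direct sum of classical weights. -/
def opolyMatrix (w : ι → ClassicalWeight t) (n : ℕ) : Matrix ι ι ℂ[X] :=
  Matrix.diagonal fun i => (w i).opoly n

theorem form_directSum_opolyMatrix (P : Matrix ι ι ℂ[X]) (n : ℕ) (i j : ι) :
    (directSum w).form P (opolyMatrix w n) i j =
      (w j).moment (P i j * ((w j).opoly n).map conj) := by
  rw [form_directSum_apply, Fintype.sum_eq_single j fun k hk => ?_, opolyMatrix,
    Matrix.diagonal_apply_eq]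
  rw [opolyMatrix, Matrix.diagonal_apply_ne' _ hk, Polynomial.map_zero, mul_zero, map_zero]

theorem isMonicOrthogonal_opolyMatrix (w : ι → ClassicalWeight t) :
    (directSum w).IsMonicOrthogonal (opolyMatrix w) where
  monic n := by
    rw [opolyMatrix, Matrix.diagonal_map (f := (coeff · n)) (coeff_zero n)]
    simp only [coeff_opoly_self, Matrix.diagonal_one]
  degree_le n m h := by
    have hcoeff : ∀ i, ((w i).opoly n).coeff m = 0 := fun i =>
      coeff_eq_zero_of_natDegree_lt (by rwa [Sequence.natDegree_eq])
    rw [opolyMatrix, Matrix.diagonal_map (f := (coeff · m)) (coeff_zero m)]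
    simp only [hcoeff, Matrix.diagonal_zero]
  orthogonal n m h := by
    ext i j
    rw [form_directSum_opolyMatrix, opolyMatrix]
    rcases eq_or_ne i j with rfl | hij
    · rw [Matrix.diagonal_apply_eq, moment_opoly_mul_conj_opoly _ h, Matrix.zero_apply]
    · rw [Matrix.diagonal_apply_ne _ hij, zero_mul, map_zero, Matrix.zero_apply]

theorem eq_opolyMatrix {P : ℕ → Matrix ι ι ℂ[X]} (hP : (directSum w).IsMonicOrthogonal P) (n : ℕ) :
    P n = opolyMatrix w n := by
  have hQ := isMonicOrthogonal_opolyMatrix w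
  induction n using Nat.strong_induction_on with
  | _ n ih =>
    ext1 i j
    refine sub_eq_zero.1 ((w j).eq_zero_of_orthogonal (hP.degree_sub_lt hQ n i j) fun m hm => ?_)
    have hPm := congrFun₂ (hP.orthogonal n m hm.ne') i j
    have hQm := congrFun₂ (hQ.orthogonal n m hm.ne') i j
    rw [ih m hm, form_directSum_opolyMatrix] at hPm
    rw [form_directSum_opolyMatrix] at hQm
    rw [sub_mul, map_sub, hPm, hQm, sub_self]

theorem matAct_opolyMatrix (n : ℕ) (D : Matrix ι ι WeylAlgebra) (i j : ι) :
    matAct (opolyMatrix w n) D i j = act ((w i).opoly n) (D i j) := by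
  rw [matAct, Matrix.of_apply, Fintype.sum_eq_single i fun k hk => ?_, opolyMatrix,
    Matrix.diagonal_apply_eq]
  rw [opolyMatrix, Matrix.diagonal_apply_ne' _ hk]
  exact map_zero _

theorem map_C_mul_opolyMatrix (n : ℕ) (L : Matrix ι ι ℂ) (i j : ι) :
    (L.map C * opolyMatrix w n) i j = L i j • (w j).opoly n := by
  rw [opolyMatrix, Matrix.mul_diagonal, Matrix.map_apply, smul_eq_C_mul]

theorem mem_diffAlgebra_directSum {D : Matrix ι ι WeylAlgebra} :
    D ∈ (directSum w).diffAlgebra ↔ ∀ i j, ∃ a, Intertwines (w i) (w j) (D i j) a := by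
  constructor
  · intro hD i j
    choose L hL using hD _ (isMonicOrthogonal_opolyMatrix w)
    exact ⟨fun n => L n i j, fun n => by
      rw [← matAct_opolyMatrix, hL, map_C_mul_opolyMatrix]⟩
  · intro hD P hP n
    choose a ha using hD
    refine ⟨Matrix.of fun i j => a i j n, ?_⟩
    ext1 i j
    rw [eq_opolyMatrix hP, matAct_opolyMatrix, map_C_mul_opolyMatrix, ha, Matrix.of_apply]

theorem single_mem_diffAlgebra {i j : ι} {V : WeylAlgebra} {a : ℕ → ℂ}
    (hV : Intertwines (w i) (w j) V a) : Matrix.single i j V ∈ (directSum w).diffAlgebra := by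
  refine mem_diffAlgebra_directSum.2 fun k l => ?_
  rw [Matrix.single_apply]
  split_ifs with h
  · obtain ⟨rfl, rfl⟩ := h
    exact ⟨a, hV⟩
  · exact ⟨0, .zero⟩

section Darboux

theorem degree_act_of_isDegreePreserving {V : Matrix Unit Unit WeylAlgebra}
    (hV : IsDegreePreserving V) (p : ℂ[X]) : (act p (V () ())).degree = p.degree := by
  have h := hV (Matrix.of fun _ _ => p)
  have huniv : (Finset.univ : Finset (Unit × Unit)) = {((), ())} := rfl
  rwa [matDegree, matDegree, huniv, Finset.sup_singleton, Finset.sup_singleton, matAct,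
    Matrix.of_apply, Fintype.sum_unique] at h

theorem Intertwines.coeff_ne_zero_of_isDegreePreserving {w w' : ClassicalWeight t}
    {V : Matrix Unit Unit WeylAlgebra} {a : ℕ → ℂ} (h : Intertwines w w' (V () ()) a)
    (hV : IsDegreePreserving V) (n : ℕ) : a n ≠ 0 := by
  intro ha
  have hdeg := degree_act_of_isDegreePreserving hV (w.opoly n)
  rw [h n, ha, zero_smul, degree_zero, eq_comm, degree_eq_bot] at hdeg
  exact w.opoly.ne_zero n hdeg

theorem exists_intertwines_of_isDarbouxTransformation {w w' : ClassicalWeight t}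
    (h : w.weight.IsDarbouxTransformation w'.weight) :
    ∃ V M a b, Intertwines w w' V a ∧ Intertwines w' w M b ∧ (∀ n, a n ≠ 0) ∧ ∀ n, b n ≠ 0 := by
  obtain ⟨V, M, hV, hM, hVM, hA⟩ := h
  choose A hA using hA _ _ (isMonicOrthogonal_opolyMatrix fun _ => w)
    (isMonicOrthogonal_opolyMatrix fun _ => w')
  have hVA : Intertwines w w' (V () ()) fun n => A n () () := fun n => by
    rw [← matAct_opolyMatrix (w := fun _ => w), hA, map_C_mul_opolyMatrix]
  have ha := hVA.coeff_ne_zero_of_isDegreePreserving hV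
  obtain ⟨c, hc⟩ := mem_diffAlgebra_directSum.1 hVM () ()
  rw [Matrix.mul_apply, Fintype.sum_unique] at hc
  have hMb := hVA.of_mul_left ha hc
  exact ⟨V () (), M () (), _, _, hVA, hMb, ha, hMb.coeff_ne_zero_of_isDegreePreserving hM⟩

end Darboux

section Center

theorem aeval_diagonal_delta (w : ι → ClassicalWeight t) (p : ℂ[X]) :
    aeval (Matrix.diagonal fun i => (w i).delta) p =
      Matrix.diagonal fun i => aeval (w i).delta p := by
  have hpi : aeval (fun i => (w i).delta) p = fun i => aeval (w i).delta p := by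
    ext1 i
    exact (aeval_algHom_apply (Pi.evalAlgHom ℂ (fun _ => WeylAlgebra) i) _ p).symm
  rw [← hpi]
  exact aeval_algHom_apply (Matrix.diagonalAlgHom ℂ) (fun i => (w i).delta) p

theorem diagonal_aeval_delta_mem_center (heig : ∀ i j, (w i).eigenvalue = (w j).eigenvalue)
    (p : ℂ[X]) : (Matrix.diagonal fun i => aeval (w i).delta p) ∈ (directSum w).center := by
  refine WeightMatrix.mem_center.2 ⟨mem_diffAlgebra_directSum.2 fun i j => ?_, fun E hE => ?_⟩
  · rcases eq_or_ne i j with rfl | hij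
    · rw [Matrix.diagonal_apply_eq]
      exact ⟨_, .aeval_delta (w i) p⟩
    · rw [Matrix.diagonal_apply_ne _ hij]
      exact ⟨0, .zero⟩
  · ext1 i j
    obtain ⟨a, ha⟩ := mem_diffAlgebra_directSum.1 hE i j
    rw [Matrix.mul_diagonal, Matrix.diagonal_mul]
    exact (ha.aeval_delta_mul (heig i j) p).symm

theorem apply_eq_zero_of_mem_center {D : Matrix ι ι WeylAlgebra} (hD : D ∈ (directSum w).center)
    {i j : ι} (hij : i ≠ j) : D i j = 0 := by
  have hE : Matrix.single i i (1 : WeylAlgebra) ∈ (directSum w).diffAlgebra :=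
    single_mem_diffAlgebra (a := 1) fun n => by rw [act_one, Pi.one_apply, one_smul]
  have h := congrFun₂ ((WeightMatrix.mem_center.1 hD).2 _ hE) i j
  rwa [Matrix.single_mul_apply_same, one_mul, Matrix.mul_single_apply_of_ne _ _ _ _ _ hij.symm] at h

theorem apply_self_eq_of_mem_center {D : Matrix ι ι WeylAlgebra} (hD : D ∈ (directSum w).center)
    {i j : ι} (heig : (w i).eigenvalue = (w j).eigenvalue) {V : WeylAlgebra} {a : ℕ → ℂ}
    (hV : Intertwines (w i) (w j) V a) (ha : ∀ n, a n ≠ 0) {p : ℂ[X]}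
    (hp : D i i = aeval (w i).delta p) : D j j = aeval (w j).delta p := by
  obtain ⟨hD, hcomm⟩ := WeightMatrix.mem_center.1 hD
  have h := congrFun₂ (hcomm _ (single_mem_diffAlgebra hV)) i j
  rw [Matrix.single_mul_apply_same, Matrix.mul_single_apply_same, hp,
    hV.aeval_delta_mul heig] at h
  obtain ⟨c, hc⟩ := mem_diffAlgebra_directSum.1 hD j j
  have hcoeff := (hV.mul hc).coeff_unique (h ▸ hV.mul (.aeval_delta (w j) p))
  rw [IsUnit.mul_right_inj (Pi.isUnit_iff.2 fun n => (ha n).isUnit)] at hcoeff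
  exact hc.ext (hcoeff ▸ .aeval_delta (w j) p)

theorem mem_center_directSum (i₀ : ι)
    (hw : ∀ i, (w i₀).weight.IsDarbouxTransformation (w i).weight)
    {D : Matrix ι ι WeylAlgebra} :
    D ∈ (directSum w).center ↔
      ∃ p : ℂ[X], D = Matrix.diagonal fun i => aeval (w i).delta p := by
  choose V M a b hV hM ha hb using fun i => exists_intertwines_of_isDarbouxTransformation (hw i)
  have heig : ∀ i, (w i₀).eigenvalue = (w i).eigenvalue := fun i =>
    (hV i).eigenvalue_eq (hM i) fun h => mul_ne_zero (ha i 0) (hb i 0) (congrFun h 0)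
  constructor
  · intro hD
    obtain ⟨c, hc⟩ := mem_diffAlgebra_directSum.1 (WeightMatrix.mem_center.1 hD).1 i₀ i₀
    obtain ⟨p, hp⟩ := hc.exists_eq_aeval_delta
    refine ⟨p, ?_⟩
    ext1 i j
    rcases eq_or_ne i j with rfl | hij
    · rw [Matrix.diagonal_apply_eq]
      exact apply_self_eq_of_mem_center hD (heig i) (hV i) (ha i) hp
    · rw [Matrix.diagonal_apply_ne _ hij, apply_eq_zero_of_mem_center hD hij]
  · rintro ⟨p, rfl⟩
    exact diagonal_aeval_delta_mem_center (fun i j => (heig i).symm.trans (heig j)) p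

theorem transcendental_delta (w : ClassicalWeight t) : Transcendental ℂ w.delta := by
  refine transcendental_iff.2 fun p hp => eq_zero_of_infinite_isRoot p
    ((Set.infinite_range_of_injective w.eigenvalue_injective).mono ?_)
  rintro _ ⟨n, rfl⟩
  exact congrFun ((hp ▸ Intertwines.aeval_delta w p).coeff_unique .zero) n

theorem transcendental_diagonal_delta [Nonempty ι] (w : ι → ClassicalWeight t) :
    Transcendental ℂ (Matrix.diagonal fun i => (w i).delta) := by
  refine transcendental_iff.2 fun p hp => ?_
  let i := Classical.arbitrary ι
  refine transcendental_iff.1 (transcendental_delta (w i)) p ?_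
  rw [aeval_diagonal_delta] at hp
  exact (Matrix.diagonal_apply_eq _ i).symm.trans (congrFun₂ hp i i)

end Center

end ClassicalWeight

end

theorem theorem5p5_general {ι : Type*} [Fintype ι] [DecidableEq ι] {t : ClassicalType}
    (w : ι → ClassicalWeight t) (i₀ : ι)
    (hw : ∀ i, (w i₀).weight.IsDarbouxTransformation (w i).weight)
    (Δ : Matrix ι ι WeylAlgebra) (hΔ : Δ = Matrix.diagonal fun i => (w i).delta) :
    (ClassicalWeight.directSum w).center = Algebra.adjoin ℂ {Δ} ∧
    Transcendental ℂ Δ ∧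
    ((ClassicalWeight.directSum w).center : Set (Matrix ι ι WeylAlgebra)) =
      {D | ∃ p : ℂ[X], D = aeval Δ p} ∧
    ((ClassicalWeight.directSum w).center : Set (Matrix ι ι WeylAlgebra)) =
      {D | ∃ p : ℂ[X], D = Matrix.diagonal fun i => aeval (w i).delta p} := by
  subst hΔ
  have : Nonempty ι := ⟨i₀⟩
  have hcenter (D : Matrix ι ι WeylAlgebra) := ClassicalWeight.mem_center_directSum i₀ hw (D := D)
  refine ⟨?_, ClassicalWeight.transcendental_diagonal_delta w, ?_, Set.ext hcenter⟩
  · ext D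
    rw [hcenter, Algebra.adjoin_singleton_eq_range_aeval]
    simp only [AlgHom.mem_range, ClassicalWeight.aeval_diagonal_delta, eq_comm]
  · simp only [ClassicalWeight.aeval_diagonal_delta]
    exact Set.ext hcenter

theorem theorem5p5 {N : ℕ} (hN : 0 < N) {t : ClassicalType} (w : Fin N → ClassicalWeight t)
    (hw : ∀ i j, (w i).weight.IsDarbouxTransformation (w j).weight)
    (Δ : Matrix (Fin N) (Fin N) WeylAlgebra)
    (hΔ : Δ = Matrix.diagonal fun j => (w j).delta) :
    (ClassicalWeight.directSum w).center = Algebra.adjoin ℂ {Δ} ∧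
    Transcendental ℂ Δ ∧
    ((ClassicalWeight.directSum w).center : Set (Matrix (Fin N) (Fin N) WeylAlgebra)) =
      {D | ∃ p : Polynomial ℂ, D = Polynomial.aeval Δ p} ∧
    ((ClassicalWeight.directSum w).center : Set (Matrix (Fin N) (Fin N) WeylAlgebra)) =
      {D | ∃ p : Polynomial ℂ,
        D = Matrix.diagonal fun j => Polynomial.aeval (w j).delta p} :=
  theorem5p5_general w ⟨0, hN⟩ (hw _) Δ hΔ
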